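/- Let $n\ge 2$ and write points of $\mathbb R^{n+1}$ as $(\mathbf x,y)\in\mathbb R^n\times\mathbb R$. For a hypersurface $\Gamma\subset\mathbb R^{n+1}$ with $n$-dimensional surface measure $\mu$ let $$\mathcal H(\Gamma)=(4\pi)^{-n/2}\int_\Gamma e^{-\|X\|^2/4}\,d\mu(X)$$ be its Huisken functional, and let $\Sigma=\{(\mathbf x,y):\|\mathbf x\|=\sqrt{2(n-1)}\}$ be the cylinder. There are constants $L_0>0$, $\delta_0>0$ and $C>0$, depending only on $n$, such that the following holds for all $L>L_0$ and $0<\delta<\delta_0$. Let $\Gamma=\{(\mathbf x,y):\|\mathbf x\|=u(y),\ |y|\le d\}$ with $d\ge 4L$ be a closed convex hypersurface of revolution which is symmetric under the reflection $y\mapsto -y$; that is, $u:[-d,d]\to[0,\infty)$ is continuous, concave and even, positive on $(-d,d)$, with $u(\pm d)=0$. Put $v(y)=u(y)-\sqrt{2(n-1)}$, and suppose that $\mathcal H(\Gamma)\le\mathcal H(\Sigma)$ and $$\sup_{|y|\le 4L}|v(y)|\le\delta .$$ Then $$\int_0^{2L}v_y^2\,e^{-y^2/4}\,dy\le C\int_0^L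 v^2\,e^{-y^2/4}\,dy \qquad\text{and}\qquad \int_L^{2L}v^2\,e^{-y^2/4}\,dy\le\frac{C}{L^2}\int_0^L v^2\,e^{-y^2/4}\,dy ,$$ where the first integral on the left is finite. -/

import Mathlib

open MeasureTheory Set

noncomputable section

/-- The ambient space `ℝⁿ × ℝ = ℝⁿ⁺¹` with coordinates `(𝐱, y)` and the Euclidean norm. -/
abbrev AmbientSpace (n : ℕ) : Type := WithLp 2 (EuclideanSpace ℝ (Fin n) × ℝ)

/-- The parametrization `(y, ω) ↦ (u(y) ω, y)`, `ω ∈ Sⁿ⁻¹`, of the hypersurface `‖𝐱‖ = u(y)`. -/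
def revolutionMap (n : ℕ) (u : ℝ → ℝ)
    (p : ℝ × Metric.sphere (0 : EuclideanSpace ℝ (Fin n)) 1) : AmbientSpace n :=
  WithLp.toLp 2 (u p.1 • (p.2 : EuclideanSpace ℝ (Fin n)), p.1)

/-- The `n`-dimensional surface measure of the hypersurface of revolution
`{(𝐱, y) : ‖𝐱‖ = u(y), y ∈ I}`, as a measure on the ambient space: the image under the
parametrization of its area element `u(y)ⁿ⁻¹ √(1 + u'(y)²) dy dσ(ω)`, where `σ` is the
standard surface measure of the unit sphere `Sⁿ⁻¹`. -/
def revolutionMeasure (n : ℕ) (I : Set ℝ) (u : ℝ → ℝ) : Measure (AmbientSpace n) :=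
  (((volume.restrict I).withDensity
      fun y => ENNReal.ofReal (u y ^ (n - 1) * √(1 + deriv u y ^ 2))).prod
    (volume : Measure (EuclideanSpace ℝ (Fin n))).toSphere).map (revolutionMap n u)

/-- Huisken's functional `(4π)^(-n/2) ∫ exp(-‖X‖²/4) dμ(X)` of a hypersurface with surface
measure `μ`, as a value in `[0, ∞]`. -/
def huisken (n : ℕ) (μ : Measure (AmbientSpace n)) : ENNReal :=
  ENNReal.ofReal ((4 * Real.pi) ^ (-(n : ℝ) / 2)) *
    ∫⁻ X, ENNReal.ofReal (Real.exp (-‖X‖ ^ 2 / 4)) ∂μ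

/-- The radius `√(2(n-1))` of the cylinder. -/
def cylinderRadius (n : ℕ) : ℝ := √(2 * ((n : ℝ) - 1))

/-- The surface measure of the cylinder `Σ = {(𝐱, y) : ‖𝐱‖ = √(2(n-1)), y ∈ ℝ}`. -/
def cylinderMeasure (n : ℕ) : Measure (AmbientSpace n) :=
  revolutionMeasure n univ fun _ => cylinderRadius n

/-- `u`, restricted to `[-d, d]`, is the profile of a closed convex hypersurface of revolution
`{(𝐱, y) : ‖𝐱‖ = u(y), |y| ≤ d}` with tips `(0, ±d)`, symmetric under `y ↦ -y`. No smoothness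
is imposed; being concave, `u` is differentiable at all but countably many points. -/
structure IsConvexProfile (d : ℝ) (u : ℝ → ℝ) : Prop where
  concave : ConcaveOn ℝ (Icc (-d) d) u
  continuous : ContinuousOn u (Icc (-d) d)
  pos : ∀ y ∈ Ioo (-d) d, 0 < u y
  tip : u d = 0
  even : ∀ y ∈ Icc (-d) d, u (-y) = u y

end

/-!
Write `w(r) = rⁿ⁻¹ exp(-r²/4)`, which is maximal at the radius `ρ` of the cylinder, so that the
Gaussian area density of the hypersurface is `w(u) √(1 + u'²) exp(-y²/4)`. For `y ≥ 4ρ` the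
function `w(u)² / w(ρ) · ∫_y^∞ exp(-s²/4) ds` decreases no faster than this density, whatever the
slope of `u`, and it vanishes at the tip. It therefore bounds the area beyond `y = 2L` from below,
and `H(Γ) ≤ H(Σ)` becomes an upper bound for the area of the inner part `y ≤ 2L`, where concavity
and `|v| ≤ 1/2` give `|u'| ≤ 1`. Expanding that area to second order around the cylinder bounds
`∫₀^{2L} v'²` by `∫₀^{2L} v²` plus a boundary term at `2L`, all with the weight `exp(-y²/4)`.
Finally, the Gaussian Poincaré inequality controls `∫ y² v²` and the boundary term by `∫ v² + v'²`;
as `y² ≥ L²` on `[L, 2L]`, for large `L` both the boundary term and the contribution of `[L, 2L]`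
can be absorbed.
-/

open Real Filter
open scoped Topology

/-- The weight `t exp((1 - t²)/2)`, with maximum `1` at `t = 1`. Up to scaling, `radialWeight m` is
its `m`-th power, see `radialWeight_mul`. -/
noncomputable def normalizedWeight (t : ℝ) : ℝ := t * exp ((1 - t ^ 2) / 2)

lemma normalizedWeight_sq (t : ℝ) : normalizedWeight t ^ 2 = t ^ 2 * exp (1 - t ^ 2) := by
  rw [normalizedWeight, mul_pow, ← exp_nat_mul]
  congr 2
  push_cast
  ring

lemma hasDerivAt_normalizedWeight (t : ℝ) :
    HasDerivAt normalizedWeight ((1 - t ^ 2) * exp ((1 - t ^ 2) / 2)) t := by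
  have h := (hasDerivAt_id t).mul ((((hasDerivAt_pow 2 t).const_sub 1).div_const 2).exp)
  refine h.congr_deriv ?_
  simp only [id, Nat.cast_ofNat, Nat.add_one_sub_one, pow_one]
  ring

lemma one_sub_two_mul_sq_le_normalizedWeight {t : ℝ} (ht : 0 ≤ t) :
    1 - 2 * (t - 1) ^ 2 ≤ normalizedWeight t := by
  rcases le_total t 2 with ht2 | ht2
  · calc 1 - 2 * (t - 1) ^ 2 = t * ((1 - t ^ 2) / 2 + 1) - (t - 1) ^ 2 * (2 - t) / 2 := by ring
      _ ≤ t * ((1 - t ^ 2) / 2 + 1) := by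
        have := mul_nonneg (sq_nonneg (t - 1)) (sub_nonneg.2 ht2)
        linarith
      _ ≤ normalizedWeight t := mul_le_mul_of_nonneg_left (add_one_le_exp _) ht
  · have : 0 ≤ normalizedWeight t := mul_nonneg ht (exp_pos _).le
    nlinarith

lemma deriv_normalizedWeight_sq_le (t : ℝ) :
    deriv normalizedWeight t ^ 2 ≤ 4 * (1 - normalizedWeight t ^ 2) := by
  have hderiv : deriv normalizedWeight t ^ 2 = (1 - t ^ 2) ^ 2 * exp (1 - t ^ 2) := by
    rw [(hasDerivAt_normalizedWeight t).deriv, mul_pow, ← exp_nat_mul]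
    congr 2
    push_cast
    ring
  have hexp : (1 - (1 - t ^ 2) / 2) ^ 2 ≤ exp (-(1 - t ^ 2)) := by
    have hle : 1 - t ^ 2 ≤ (2 : ℕ) := by
      push_cast
      linarith [sq_nonneg t]
    simpa only [Nat.cast_ofNat] using one_sub_div_pow_le_exp_neg hle
  have hinv : exp (-(1 - t ^ 2)) * exp (1 - t ^ 2) = 1 := by
    rw [← exp_add, neg_add_cancel, exp_zero]
  rw [hderiv, normalizedWeight_sq]
  linear_combination 4 * exp (1 - t ^ 2) * hexp + 4 * hinv

/-- The radial factor `rᵐ exp(-r²/4)` of the Gaussian area density. -/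
noncomputable def radialWeight (m : ℕ) (r : ℝ) : ℝ := r ^ m * exp (-r ^ 2 / 4)

section RadialWeight

variable {m : ℕ} {ρ r : ℝ}

lemma contDiff_radialWeight (m : ℕ) : ContDiff ℝ 1 (radialWeight m) := by
  unfold radialWeight
  fun_prop

lemma radialWeight_nonneg (m : ℕ) (hr : 0 ≤ r) : 0 ≤ radialWeight m r := by
  unfold radialWeight
  positivity

lemma radialWeight_pos (m : ℕ) (hr : 0 < r) : 0 < radialWeight m r := by
  unfold radialWeight
  positivity

lemma radialWeight_mul (hρ : ρ ^ 2 = 2 * m) (t : ℝ) :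
    radialWeight m (ρ * t) = radialWeight m ρ * normalizedWeight t ^ m := by
  have hexp : exp (-(ρ * t) ^ 2 / 4) = exp (-ρ ^ 2 / 4) * exp (m * ((1 - t ^ 2) / 2)) := by
    rw [← exp_add, mul_pow, hρ]
    ring_nf
  rw [radialWeight, radialWeight, normalizedWeight, mul_pow t, ← exp_nat_mul, hexp]
  ring

lemma mul_deriv_radialWeight_mul (hρ : ρ ^ 2 = 2 * m) (t : ℝ) :
    ρ * deriv (radialWeight m) (ρ * t) =
      radialWeight m ρ * (m * normalizedWeight t ^ (m - 1) * deriv normalizedWeight t) := by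
  have hscale : (fun t => radialWeight m (ρ * t)) =
      fun t => radialWeight m ρ * normalizedWeight t ^ m := funext (radialWeight_mul hρ)
  have hdiff := (hasDerivAt_normalizedWeight t).differentiableAt
  rw [← smul_eq_mul, ← deriv_comp_mul_left, hscale, deriv_const_mul_field,
    deriv_fun_pow hdiff]

lemma radialWeight_mul_one_sub_sq_le (hρ0 : 0 < ρ) (hρ : ρ ^ 2 = 2 * m) (hr : 0 ≤ r) :
    radialWeight m ρ * (1 - (r - ρ) ^ 2) ≤ radialWeight m r := by
  obtain ⟨t, rfl⟩ : ∃ t, r = ρ * t := ⟨r / ρ, by field_simp⟩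
  have ht : 0 ≤ t := nonneg_of_mul_nonneg_right hr hρ0
  have hφ0 : 0 ≤ normalizedWeight t := mul_nonneg ht (exp_pos _).le
  rw [radialWeight_mul hρ]
  refine mul_le_mul_of_nonneg_left ?_ (radialWeight_nonneg m hρ0.le)
  calc 1 - (ρ * t - ρ) ^ 2 = 1 + m * ((1 - 2 * (t - 1) ^ 2) - 1) := by
        linear_combination -(t - 1) ^ 2 * hρ
    _ ≤ 1 + m * (normalizedWeight t - 1) := by
        gcongr
        exact one_sub_two_mul_sq_le_normalizedWeight ht
    _ ≤ normalizedWeight t ^ m := by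
        simpa using one_add_mul_le_pow (a := normalizedWeight t - 1) (by linarith) m

lemma deriv_radialWeight_sq_le (hρ0 : ρ ≠ 0) (hρ : ρ ^ 2 = 2 * m) (r : ℝ) :
    deriv (radialWeight m) r ^ 2 ≤ ρ ^ 2 * (radialWeight m ρ ^ 2 - radialWeight m r ^ 2) := by
  obtain ⟨t, rfl⟩ : ∃ t, r = ρ * t := ⟨r / ρ, by field_simp⟩
  have hm : m ≠ 0 := by
    rintro rfl
    simp_all
  have hslope := deriv_normalizedWeight_sq_le t
  have hscaled := mul_deriv_radialWeight_mul hρ t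
  rw [radialWeight_mul hρ]
  set W := radialWeight m ρ
  set φ := normalizedWeight t
  have hφ : (φ ^ 2) ^ (m - 1) ≤ 1 :=
    pow_le_one₀ (sq_nonneg φ) (by nlinarith [sq_nonneg (deriv normalizedWeight t)])
  have hpow : φ ^ 2 * (φ ^ 2) ^ (m - 1) = (φ ^ m) ^ 2 := by
    rw [mul_pow_sub_one hm, pow_right_comm]
  refine le_of_mul_le_mul_left ?_ (by positivity : 0 < ρ ^ 2)
  calc ρ ^ 2 * deriv (radialWeight m) (ρ * t) ^ 2
      = W ^ 2 * m ^ 2 * (φ ^ 2) ^ (m - 1) * deriv normalizedWeight t ^ 2 := by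
        rw [← mul_pow, hscaled]
        ring
    _ ≤ W ^ 2 * m ^ 2 * (φ ^ 2) ^ (m - 1) * (4 * (1 - φ ^ 2)) := by gcongr
    _ = 4 * W ^ 2 * m ^ 2 * ((φ ^ 2) ^ (m - 1) - (φ ^ m) ^ 2) := by
        rw [← hpow]
        ring
    _ ≤ 4 * W ^ 2 * m ^ 2 * (1 - (φ ^ m) ^ 2) := by gcongr
    _ = ρ ^ 2 * (ρ ^ 2 * (W ^ 2 - (W * φ ^ m) ^ 2)) := by
        rw [hρ]
        ring

end RadialWeight

lemma hasDerivAt_exp_neg_sq_div_four (y : ℝ) :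
    HasDerivAt (fun s : ℝ => exp (-s ^ 2 / 4)) (-(y / 2) * exp (-y ^ 2 / 4)) y := by
  refine (((hasDerivAt_pow 2 y).fun_neg.div_const 4).exp).congr_deriv ?_
  simp only [Nat.cast_ofNat, Nat.add_one_sub_one, pow_one]
  ring

lemma tendsto_exp_neg_sq_div_four_atTop :
    Tendsto (fun s : ℝ => exp (-s ^ 2 / 4)) atTop (𝓝 0) := by
  refine tendsto_exp_atBot.comp (Tendsto.congr (f₁ := fun s : ℝ => -1 / 4 * s ^ 2)
    (fun s => by ring) ?_)
  exact (tendsto_pow_atTop two_ne_zero).const_mul_atTop_of_neg (by norm_num)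

lemma integrable_exp_neg_sq_div_four : Integrable fun s : ℝ => exp (-s ^ 2 / 4) := by
  convert integrable_exp_neg_mul_sq (b := 1 / 4) (by norm_num) using 3
  ring

lemma integrable_mul_exp_neg_sq_div_four : Integrable fun s : ℝ => s * exp (-s ^ 2 / 4) := by
  convert integrable_mul_exp_neg_mul_sq (b := 1 / 4) (by norm_num) using 4
  ring

/-- The Gaussian tail `∫_y^∞ exp(-s²/4) ds`. -/
noncomputable def gaussianTail (y : ℝ) : ℝ := ∫ s in Ioi y, exp (-s ^ 2 / 4)

lemma gaussianTail_nonneg (y : ℝ) : 0 ≤ gaussianTail y :=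
  integral_nonneg fun _ => (exp_pos _).le

lemma integral_exp_add_gaussianTail (a b : ℝ) :
    (∫ s in a..b, exp (-s ^ 2 / 4)) + gaussianTail b = gaussianTail a :=
  intervalIntegral.integral_interval_add_Ioi integrable_exp_neg_sq_div_four.integrableOn
    integrable_exp_neg_sq_div_four.integrableOn

lemma integral_exp_neg_sq_div_four : ∫ s : ℝ, exp (-s ^ 2 / 4) = 2 * gaussianTail 0 := by
  have h := integral_comp_abs (f := fun s : ℝ => exp (-s ^ 2 / 4))
  simp only [sq_abs] at h
  exact h

lemma hasDerivAt_gaussianTail (y : ℝ) : HasDerivAt gaussianTail (-exp (-y ^ 2 / 4)) y := by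
  have hc : Continuous fun s : ℝ => exp (-s ^ 2 / 4) := by fun_prop
  have h : gaussianTail = fun y => gaussianTail 0 - ∫ s in (0 : ℝ)..y, exp (-s ^ 2 / 4) :=
    funext fun y => eq_sub_of_add_eq' (integral_exp_add_gaussianTail 0 y)
  rw [h]
  exact (hc.integral_hasStrictDerivAt 0 y).hasDerivAt.const_sub _

lemma contDiff_gaussianTail : ContDiff ℝ 1 gaussianTail := by
  have hderiv : deriv gaussianTail = fun y => -exp (-y ^ 2 / 4) :=
    funext fun y => (hasDerivAt_gaussianTail y).deriv
  rw [contDiff_one_iff_deriv, hderiv]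
  exact ⟨fun y => (hasDerivAt_gaussianTail y).differentiableAt, by fun_prop⟩

lemma integral_Ioi_mul_exp_neg_sq_div_four (y : ℝ) :
    ∫ s in Ioi y, s * exp (-s ^ 2 / 4) = 2 * exp (-y ^ 2 / 4) := by
  have hderiv : ∀ s ∈ Ici y,
      HasDerivAt (fun s : ℝ => -2 * exp (-s ^ 2 / 4)) (s * exp (-s ^ 2 / 4)) s := fun s _ =>
    ((hasDerivAt_exp_neg_sq_div_four s).const_mul (-2)).congr_deriv (by ring)
  rw [integral_Ioi_of_hasDerivAt_of_tendsto' hderiv integrable_mul_exp_neg_sq_div_four.integrableOn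
    (tendsto_exp_neg_sq_div_four_atTop.const_mul (-2))]
  ring

lemma mul_gaussianTail_le (y : ℝ) : y * gaussianTail y ≤ 2 * exp (-y ^ 2 / 4) := by
  rw [gaussianTail, ← integral_const_mul, ← integral_Ioi_mul_exp_neg_sq_div_four]
  exact setIntegral_mono_on (integrable_exp_neg_sq_div_four.const_mul y).integrableOn
    integrable_mul_exp_neg_sq_div_four.integrableOn measurableSet_Ioi
    fun s hs => mul_le_mul_of_nonneg_right (le_of_lt hs) (exp_pos _).le

section LipschitzOnInterval

variable {u : ℝ → ℝ} {a b : ℝ} {K : NNReal}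

lemma sub_le_integral_of_ae_deriv_le {f g : ℝ → ℝ} (hab : a ≤ b)
    (hf : AbsolutelyContinuousOnInterval f a b) (hg : IntervalIntegrable g volume a b)
    (hle : ∀ᵐ y ∂volume.restrict (Icc a b), deriv f y ≤ g y) :
    f b - f a ≤ ∫ y in a..b, g y := by
  rw [← hf.integral_deriv_eq_sub]
  exact intervalIntegral.integral_mono_ae_restrict hab hf.intervalIntegrable_deriv hg hle

lemma ae_restrict_differentiableAt_of_lipschitzOn (hu : LipschitzOnWith K u (Icc a b)) :
    ∀ᵐ y ∂volume.restrict (Icc a b), DifferentiableAt ℝ u y := by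
  rw [ae_restrict_iff' measurableSet_Icc]
  rcases le_or_gt a b with hab | hab
  · rw [← uIcc_of_le hab] at hu ⊢
    exact hu.absolutelyContinuousOnInterval.ae_differentiableAt
  · simp [Icc_eq_empty_of_lt hab]

lemma absolutelyContinuousOnInterval_comp_of_contDiff {h : ℝ → ℝ} (hh : ContDiff ℝ 1 h)
    (hu : LipschitzOnWith K u (uIcc a b)) :
    AbsolutelyContinuousOnInterval (fun y => h (u y)) a b := by
  obtain ⟨K', hK'⟩ := LocallyLipschitzOn.exists_lipschitzOnWith_of_compact
    (isCompact_uIcc.image_of_continuousOn hu.continuousOn)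
    (hh.locallyLipschitz.locallyLipschitzOn (s := u '' uIcc a b))
  exact (hK'.comp hu (mapsTo_image u _)).absolutelyContinuousOnInterval

lemma intervalIntegrable_comp_deriv_of_lipschitzOn {φ : ℝ → ℝ} (hab : a ≤ b)
    (hu : LipschitzOnWith K u (Icc a b)) (hφ : Continuous φ) :
    IntervalIntegrable (fun y => φ (deriv u y)) volume a b := by
  obtain ⟨M, hM⟩ := (isCompact_Icc (a := -(K : ℝ)) (b := K)).exists_bound_of_continuousOn
    hφ.continuousOn
  rw [intervalIntegrable_iff_integrableOn_Ioo_of_le hab]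
  refine Measure.integrableOn_of_bounded (M := M) (by simp)
    (hφ.measurable.comp (measurable_deriv u)).aestronglyMeasurable ?_
  filter_upwards [ae_restrict_mem measurableSet_Ioo] with y hy
  exact hM _ (abs_le.1 (norm_deriv_le_of_lipschitzOn (Icc_mem_nhds hy.1 hy.2) hu))

end LipschitzOnInterval

/-- The squared Gaussian-weighted `L²` norm `∫ f² exp(-y²/4) dy` of `f` on the interval from `a`
to `b`. -/
noncomputable def gaussianNormSq (f : ℝ → ℝ) (a b : ℝ) : ℝ :=
  ∫ y in a..b, f y ^ 2 * exp (-y ^ 2 / 4)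

section GaussianNormSq

variable {v : ℝ → ℝ} {a b : ℝ} {K : NNReal}

lemma gaussianNormSq_nonneg (f : ℝ → ℝ) (hab : a ≤ b) : 0 ≤ gaussianNormSq f a b :=
  intervalIntegral.integral_nonneg hab fun _ _ => by positivity

lemma intervalIntegrable_sq_mul_exp (hv : ContinuousOn v (uIcc a b)) :
    IntervalIntegrable (fun y => v y ^ 2 * exp (-y ^ 2 / 4)) volume a b :=
  ((hv.pow 2).mul (by fun_prop)).intervalIntegrable

lemma intervalIntegrable_deriv_sq_mul_exp (hab : a ≤ b) (hv : LipschitzOnWith K v (Icc a b)) :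
    IntervalIntegrable (fun y => deriv v y ^ 2 * exp (-y ^ 2 / 4)) volume a b :=
  (intervalIntegrable_comp_deriv_of_lipschitzOn (φ := (· ^ 2)) hab hv
    (by fun_prop)).mul_continuousOn (by fun_prop)

lemma gaussianNormSq_add_gaussianNormSq (ha : 0 ≤ a) (hab : a ≤ b)
    (hv : ContinuousOn v (Icc 0 b)) :
    gaussianNormSq v 0 a + gaussianNormSq v a b = gaussianNormSq v 0 b :=
  intervalIntegral.integral_add_adjacent_intervals
    (intervalIntegrable_sq_mul_exp (hv.mono (by grind [uIcc_of_le])))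
    (intervalIntegrable_sq_mul_exp (hv.mono (by grind [uIcc_of_le])))

lemma deriv_mul_exp_mul_sq_le {y : ℝ} (hv : DifferentiableAt ℝ v y) :
    deriv (fun y => y * exp (-y ^ 2 / 4) * v y ^ 2) y ≤
      v y ^ 2 * exp (-y ^ 2 / 4) + 4 * (deriv v y ^ 2 * exp (-y ^ 2 / 4))
        - 1 / 4 * ((y * v y) ^ 2 * exp (-y ^ 2 / 4)) := by
  have hderiv : deriv (fun y => y * exp (-y ^ 2 / 4) * v y ^ 2) y =
      (1 * exp (-y ^ 2 / 4) + y * (-(y / 2) * exp (-y ^ 2 / 4))) * v y ^ 2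
        + y * exp (-y ^ 2 / 4) * (2 * v y * deriv v y) := by
    simpa using (((hasDerivAt_id y).fun_mul (hasDerivAt_exp_neg_sq_div_four y)).fun_mul
      (hv.hasDerivAt.fun_pow 2)).deriv
  have hsq : 0 ≤ (y * v y / 2 - 2 * deriv v y) ^ 2 * exp (-y ^ 2 / 4) := by positivity
  rw [hderiv]
  linear_combination hsq

/-- Integrating the derivative of `y exp(-y²/4) v²` and absorbing the cross term by Cauchy's
inequality gains the factor `y²` on the left. -/
lemma gaussian_poincare (ha : 0 ≤ a) (hv : LipschitzOnWith K v (Icc 0 a)) :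
    a * exp (-a ^ 2 / 4) * v a ^ 2 + 1 / 4 * gaussianNormSq (fun y => y * v y) 0 a ≤
      gaussianNormSq v 0 a + 4 * gaussianNormSq (deriv v) 0 a := by
  have hvu : LipschitzOnWith K v (uIcc 0 a) := by rwa [uIcc_of_le ha]
  have hweight : ContDiff ℝ 1 fun y : ℝ => y * exp (-y ^ 2 / 4) := by fun_prop
  have hAC := hweight.contDiffOn.absolutelyContinuousOnInterval.fun_mul
    (absolutelyContinuousOnInterval_comp_of_contDiff (h := (· ^ 2)) (by fun_prop) hvu)
  have hintv := intervalIntegrable_sq_mul_exp hvu.continuousOn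
  have hintyv := intervalIntegrable_sq_mul_exp (continuousOn_id.mul hvu.continuousOn)
  have hintdv := intervalIntegrable_deriv_sq_mul_exp ha hv
  have hFTC := sub_le_integral_of_ae_deriv_le ha hAC
    ((hintv.add (hintdv.const_mul 4)).sub (hintyv.const_mul (1 / 4)))
    ((ae_restrict_differentiableAt_of_lipschitzOn hv).mono fun y hy => deriv_mul_exp_mul_sq_le hy)
  rw [intervalIntegral.integral_sub (hintv.add (hintdv.const_mul 4)) (hintyv.const_mul _),
    intervalIntegral.integral_add hintv (hintdv.const_mul 4),
    intervalIntegral.integral_const_mul, intervalIntegral.integral_const_mul] at hFTC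
  simp only [zero_mul, sub_zero] at hFTC
  simp only [gaussianNormSq]
  exact le_sub_iff_add_le.1 hFTC

lemma sq_mul_gaussianNormSq_le (ha : 0 ≤ a) (hab : a ≤ b) (hv : ContinuousOn v (Icc 0 b)) :
    a ^ 2 * gaussianNormSq v a b ≤ gaussianNormSq (fun y => y * v y) 0 b := by
  have hvab : ContinuousOn v (uIcc a b) := hv.mono (by grind [uIcc_of_le])
  have hfar : a ^ 2 * gaussianNormSq v a b ≤ gaussianNormSq (fun y => y * v y) a b := by
    rw [gaussianNormSq, ← intervalIntegral.integral_const_mul]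
    refine intervalIntegral.integral_mono_on hab
      ((intervalIntegrable_sq_mul_exp hvab).const_mul _)
      (intervalIntegrable_sq_mul_exp (continuousOn_id.mul hvab)) fun y hy => ?_
    have hay : a ^ 2 ≤ y ^ 2 := pow_le_pow_left₀ ha hy.1 2
    calc a ^ 2 * (v y ^ 2 * exp (-y ^ 2 / 4)) ≤ y ^ 2 * (v y ^ 2 * exp (-y ^ 2 / 4)) := by gcongr
      _ = (y * v y) ^ 2 * exp (-y ^ 2 / 4) := by ring
  have hsplit := gaussianNormSq_add_gaussianNormSq ha hab (continuousOn_id.fun_mul hv)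
  have hnear := gaussianNormSq_nonneg (fun y => y * v y) ha
  simp only [id] at hsplit
  linarith

lemma sq_mul_gaussianNormSq_le_of_lipschitzOn (ha : 0 ≤ a) (hab : a ≤ b)
    (hv : LipschitzOnWith K v (Icc 0 b)) :
    a ^ 2 * gaussianNormSq v a b ≤
      4 * (gaussianNormSq v 0 b + 4 * gaussianNormSq (deriv v) 0 b) := by
  have hb : 0 ≤ b := ha.trans hab
  have hboundary : 0 ≤ b * exp (-b ^ 2 / 4) * v b ^ 2 := by positivity
  linarith [gaussian_poincare hb hv, sq_mul_gaussianNormSq_le ha hab hv.continuousOn]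

lemma sq_mul_sq_mul_gaussianTail_le (ha : 0 ≤ a) (hv : LipschitzOnWith K v (Icc 0 a)) :
    a ^ 2 * (v a ^ 2 * gaussianTail a) ≤
      2 * (gaussianNormSq v 0 a + 4 * gaussianNormSq (deriv v) 0 a) := by
  have htail : a * v a ^ 2 * (a * gaussianTail a) ≤ a * v a ^ 2 * (2 * exp (-a ^ 2 / 4)) :=
    mul_le_mul_of_nonneg_left (mul_gaussianTail_le a) (by positivity)
  linarith [gaussian_poincare ha hv, gaussianNormSq_nonneg (fun y => y * v y) ha]

lemma gaussianNormSq_le_of_energy_le {L : ℝ} (hL : 20 ≤ L)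
    (hv : LipschitzOnWith K v (Icc 0 (2 * L)))
    (henergy : 3 / 16 * gaussianNormSq (deriv v) 0 (2 * L) ≤
      gaussianNormSq v 0 (2 * L) + 2 * (v (2 * L) ^ 2 * gaussianTail (2 * L))) :
    gaussianNormSq (deriv v) 0 (2 * L) ≤ 200 * gaussianNormSq v 0 L ∧
      L ^ 2 * gaussianNormSq v L (2 * L) ≤ 200 * gaussianNormSq v 0 L := by
  have hL0 : 0 ≤ L := by linarith
  have hfar := sq_mul_gaussianNormSq_le_of_lipschitzOn hL0 (by linarith) hv
  have hboundary := sq_mul_sq_mul_gaussianTail_le (by linarith) hv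
  have hJ := gaussianNormSq_nonneg v hL0
  have hT := gaussianNormSq_nonneg v (by linarith : L ≤ 2 * L)
  have hB : 0 ≤ v (2 * L) ^ 2 * gaussianTail (2 * L) :=
    mul_nonneg (sq_nonneg _) (gaussianTail_nonneg _)
  rw [← gaussianNormSq_add_gaussianNormSq hL0 (by linarith) hv.continuousOn]
    at henergy hfar hboundary
  have hL2 : 400 ≤ L ^ 2 := by nlinarith
  have hfar' := (mul_le_mul_of_nonneg_right hL2 hT).trans hfar
  have hboundary' := (mul_le_mul_of_nonneg_right (by linarith : 1600 ≤ (2 * L) ^ 2) hB).trans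
    hboundary
  constructor <;> linarith

end GaussianNormSq

/-- The Gaussian area density of the hypersurface of revolution with profile `u`, up to the area
of the unit sphere; here `m + 1` is the dimension of the hypersurface. -/
noncomputable def gaussianDensity (m : ℕ) (u : ℝ → ℝ) (y : ℝ) : ℝ :=
  radialWeight m (u y) * √(1 + deriv u y ^ 2) * exp (-y ^ 2 / 4)

/-- The calibration `w(u)² / w(ρ) · ∫_y^∞ exp(-s²/4) ds` with `w = radialWeight m`. For `y ≥ 4ρ`
its decay rate along any profile `u` is at most the Gaussian area density of `u`, and on the
cylinder `u = ρ` it is the Gaussian area beyond `y`. -/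
noncomputable def calibration (m : ℕ) (ρ : ℝ) (u : ℝ → ℝ) (y : ℝ) : ℝ :=
  radialWeight m (u y) ^ 2 / radialWeight m ρ * gaussianTail y

section Calibration

variable {m : ℕ} {ρ a b : ℝ} {u : ℝ → ℝ} {K : NNReal}

lemma gaussianDensity_nonneg (m : ℕ) {y : ℝ} (hu : 0 ≤ u y) : 0 ≤ gaussianDensity m u y :=
  mul_nonneg (mul_nonneg (radialWeight_nonneg m hu) (sqrt_nonneg _)) (exp_pos _).le

lemma intervalIntegrable_gaussianDensity (m : ℕ) (hab : a ≤ b)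
    (hu : LipschitzOnWith K u (Icc a b)) :
    IntervalIntegrable (gaussianDensity m u) volume a b := by
  have hc : ContinuousOn (fun y => radialWeight m (u y)) (uIcc a b) := by
    rw [uIcc_of_le hab]
    exact (contDiff_radialWeight m).continuous.comp_continuousOn hu.continuousOn
  exact ((intervalIntegrable_comp_deriv_of_lipschitzOn (φ := fun p => √(1 + p ^ 2)) hab hu
    (by fun_prop)).continuousOn_mul hc).mul_continuousOn (by fun_prop)

lemma hasDerivAt_calibration (m : ℕ) (ρ : ℝ) {y : ℝ} (hu : DifferentiableAt ℝ u y) :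
    HasDerivAt (calibration m ρ u)
      (2 * radialWeight m (u y) * (deriv (radialWeight m) (u y) * deriv u y) / radialWeight m ρ
          * gaussianTail y
        - radialWeight m (u y) ^ 2 / radialWeight m ρ * exp (-y ^ 2 / 4)) y := by
  have hw := ((contDiff_radialWeight m).differentiable one_ne_zero (u y)).hasDerivAt
  refine ((((hw.comp y hu.hasDerivAt).fun_pow 2).div_const (radialWeight m ρ)).fun_mul
    (hasDerivAt_gaussianTail y)).congr_deriv ?_
  simp only [Function.comp_apply, Nat.cast_ofNat, Nat.add_one_sub_one, pow_one]
  ring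

lemma absolutelyContinuousOnInterval_calibration (m : ℕ) (ρ : ℝ)
    (hu : LipschitzOnWith K u (uIcc a b)) :
    AbsolutelyContinuousOnInterval (calibration m ρ u) a b :=
  (absolutelyContinuousOnInterval_comp_of_contDiff
    (h := fun r => radialWeight m r ^ 2 / radialWeight m ρ)
    (((contDiff_radialWeight m).pow 2).div_const _) hu).fun_mul
    contDiff_gaussianTail.contDiffOn.absolutelyContinuousOnInterval

lemma sq_add_sq_le_radialWeight_sq (hρ0 : 0 < ρ) (hρ : ρ ^ 2 = 2 * m) (r : ℝ) {θ : ℝ}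
    (hθ0 : 0 ≤ θ) (hθ : 2 * ρ * θ ≤ 1) :
    radialWeight m r ^ 2 + (2 * deriv (radialWeight m) r * θ) ^ 2 ≤ radialWeight m ρ ^ 2 := by
  have hslope := deriv_radialWeight_sq_le hρ0.ne' hρ r
  have hgap : 0 ≤ radialWeight m ρ ^ 2 - radialWeight m r ^ 2 :=
    nonneg_of_mul_nonneg_right ((sq_nonneg _).trans hslope) (by positivity)
  have hθsq : (2 * ρ * θ) ^ 2 ≤ 1 := pow_le_one₀ (by positivity) hθ
  calc radialWeight m r ^ 2 + (2 * deriv (radialWeight m) r * θ) ^ 2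
      = radialWeight m r ^ 2 + 4 * θ ^ 2 * deriv (radialWeight m) r ^ 2 := by ring
    _ ≤ radialWeight m r ^ 2
        + 4 * θ ^ 2 * (ρ ^ 2 * (radialWeight m ρ ^ 2 - radialWeight m r ^ 2)) := by gcongr
    _ = radialWeight m r ^ 2
        + (2 * ρ * θ) ^ 2 * (radialWeight m ρ ^ 2 - radialWeight m r ^ 2) := by ring
    _ ≤ radialWeight m r ^ 2
        + 1 * (radialWeight m ρ ^ 2 - radialWeight m r ^ 2) := by gcongr
    _ = radialWeight m ρ ^ 2 := by ring

lemma sub_mul_le_mul_sqrt_one_add_sq {F G W : ℝ} (hW : 0 ≤ W) (h : F ^ 2 + G ^ 2 ≤ W ^ 2)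
    (p : ℝ) : F - G * p ≤ W * √(1 + p ^ 2) := by
  refine (abs_le_of_sq_le_sq' ?_ (by positivity)).2
  rw [mul_pow, sq_sqrt (by positivity)]
  calc (F - G * p) ^ 2 = (F ^ 2 + G ^ 2) * (1 + p ^ 2) - (F * p + G) ^ 2 := by ring
    _ ≤ (F ^ 2 + G ^ 2) * (1 + p ^ 2) := sub_le_self _ (sq_nonneg _)
    _ ≤ W ^ 2 * (1 + p ^ 2) := by gcongr

lemma neg_deriv_calibration_le (hρ0 : 0 < ρ) (hρ : ρ ^ 2 = 2 * m) {y : ℝ} (hy : 4 * ρ ≤ y)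
    (hu : DifferentiableAt ℝ u y) (hu0 : 0 ≤ u y) :
    -deriv (calibration m ρ u) y ≤ gaussianDensity m u y := by
  have hW := radialWeight_pos m hρ0
  have hF := radialWeight_nonneg m hu0
  have hE := exp_pos (-y ^ 2 / 4)
  obtain ⟨θ, hθ⟩ : ∃ θ, gaussianTail y = θ * exp (-y ^ 2 / 4) :=
    ⟨gaussianTail y / exp (-y ^ 2 / 4), by field_simp⟩
  have hθ0 : 0 ≤ θ := nonneg_of_mul_nonneg_left (hθ ▸ gaussianTail_nonneg y) hE
  have hyθ : y * θ ≤ 2 := by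
    refine le_of_mul_le_mul_right ?_ hE
    rw [mul_assoc, ← hθ]
    exact mul_gaussianTail_le y
  have hρθ : 2 * ρ * θ ≤ 1 := by linarith [mul_le_mul_of_nonneg_right hy hθ0]
  have hsqrt := sub_mul_le_mul_sqrt_one_add_sq hW.le
    (sq_add_sq_le_radialWeight_sq hρ0 hρ (u y) hθ0 hρθ) (deriv u y)
  rw [(hasDerivAt_calibration m ρ hu).deriv, hθ, gaussianDensity]
  set W := radialWeight m ρ
  set F := radialWeight m (u y)
  set D := deriv (radialWeight m) (u y)
  set p := deriv u y
  set E := exp (-y ^ 2 / 4)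
  calc -(2 * F * (D * p) / W * (θ * E) - F ^ 2 / W * E)
      = F * E / W * (F - 2 * D * θ * p) := by ring
    _ ≤ F * E / W * (W * √(1 + p ^ 2)) := by gcongr
    _ = F * √(1 + p ^ 2) * E := by field_simp

lemma calibration_sub_calibration_le (hρ0 : 0 < ρ) (hρ : ρ ^ 2 = 2 * m) (ha : 4 * ρ ≤ a)
    (hab : a ≤ b) (hu : LipschitzOnWith K u (Icc a b)) (hu0 : ∀ y ∈ Icc a b, 0 ≤ u y) :
    calibration m ρ u a - calibration m ρ u b ≤ ∫ y in a..b, gaussianDensity m u y := by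
  have hAC := (absolutelyContinuousOnInterval_calibration m ρ (by rwa [uIcc_of_le hab])).neg
  have hFTC := sub_le_integral_of_ae_deriv_le hab hAC
    (intervalIntegrable_gaussianDensity m hab hu) ?_
  · simpa only [Pi.neg_apply, neg_sub_neg] using hFTC
  filter_upwards [ae_restrict_differentiableAt_of_lipschitzOn hu,
    ae_restrict_mem measurableSet_Icc] with y hdiff hy
  rw [deriv.neg]
  exact neg_deriv_calibration_le hρ0 hρ (ha.trans hy.1) hdiff (hu0 y hy)

end Calibration

section Energy

variable {m : ℕ} {ρ a : ℝ} {u : ℝ → ℝ}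

lemma one_add_sq_div_four_le_sqrt {p : ℝ} (hp : |p| ≤ 1) : 1 + p ^ 2 / 4 ≤ √(1 + p ^ 2) := by
  have hp2 : p ^ 2 ≤ 1 := (sq_le_one_iff_abs_le_one p).2 hp
  exact le_sqrt_of_sq_le (by nlinarith [sq_nonneg p])

lemma radialWeight_mul_le_mul_sqrt (hρ0 : 0 < ρ) (hρ : ρ ^ 2 = 2 * m) {r p : ℝ} (hr0 : 0 ≤ r)
    (hr : |r - ρ| ≤ 1 / 2) (hp : |p| ≤ 1) :
    radialWeight m ρ * (1 - (r - ρ) ^ 2 + 3 / 16 * p ^ 2) ≤ radialWeight m r * √(1 + p ^ 2) := by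
  have hW := radialWeight_nonneg m hρ0.le
  have hr2 : (r - ρ) ^ 2 ≤ (1 / 2) ^ 2 := sq_le_sq' (abs_le.1 hr).1 (abs_le.1 hr).2
  calc radialWeight m ρ * (1 - (r - ρ) ^ 2 + 3 / 16 * p ^ 2)
      ≤ radialWeight m ρ * ((1 - (r - ρ) ^ 2) * (1 + p ^ 2 / 4)) := by
        gcongr
        nlinarith [mul_le_mul_of_nonneg_right hr2 (sq_nonneg p)]
    _ = radialWeight m ρ * (1 - (r - ρ) ^ 2) * (1 + p ^ 2 / 4) := by ring
    _ ≤ radialWeight m r * √(1 + p ^ 2) :=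
        mul_le_mul (radialWeight_mul_one_sub_sq_le hρ0 hρ hr0) (one_add_sq_div_four_le_sqrt hp)
          (by positivity) (radialWeight_nonneg m hr0)

lemma radialWeight_mul_gaussianNormSq_le_integral (hρ0 : 0 < ρ) (hρ : ρ ^ 2 = 2 * m) (ha : 0 ≤ a)
    (hu : LipschitzOnWith 1 u (Icc 0 a)) (hu0 : ∀ y ∈ Icc 0 a, 0 ≤ u y)
    (huρ : ∀ y ∈ Icc 0 a, |u y - ρ| ≤ 1 / 2) :
    radialWeight m ρ * ((∫ y in (0 : ℝ)..a, exp (-y ^ 2 / 4))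
        - gaussianNormSq (fun y => u y - ρ) 0 a + 3 / 16 * gaussianNormSq (deriv u) 0 a) ≤
      ∫ y in (0 : ℝ)..a, gaussianDensity m u y := by
  have hexp : IntervalIntegrable (fun y : ℝ => exp (-y ^ 2 / 4)) volume 0 a :=
    integrable_exp_neg_sq_div_four.intervalIntegrable
  have hv : IntervalIntegrable (fun y => (u y - ρ) ^ 2 * exp (-y ^ 2 / 4)) volume 0 a :=
    intervalIntegrable_sq_mul_exp
      ((hu.continuousOn.mono (uIcc_of_le ha).subset).sub continuousOn_const)
  have hdu := intervalIntegrable_deriv_sq_mul_exp ha hu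
  simp only [gaussianNormSq]
  rw [← intervalIntegral.integral_sub hexp hv, ← intervalIntegral.integral_const_mul,
    ← intervalIntegral.integral_add (hexp.sub hv) (hdu.const_mul _),
    ← intervalIntegral.integral_const_mul]
  refine intervalIntegral.integral_mono_on_of_le_Ioo ha
    (((hexp.sub hv).add (hdu.const_mul _)).const_mul _)
    (intervalIntegrable_gaussianDensity m ha hu) fun y hy => ?_
  have hyI := Ioo_subset_Icc_self hy
  have hslope : |deriv u y| ≤ 1 := by
    simpa using norm_deriv_le_of_lipschitzOn (Icc_mem_nhds hy.1 hy.2) hu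
  have hpointwise := mul_le_mul_of_nonneg_right
    (radialWeight_mul_le_mul_sqrt hρ0 hρ (hu0 y hyI) (huρ y hyI) hslope)
    (exp_pos (-y ^ 2 / 4)).le
  rw [gaussianDensity]
  linarith

lemma radialWeight_mul_gaussianTail_le_calibration (hρ0 : 0 < ρ) (hρ : ρ ^ 2 = 2 * m)
    (hu0 : 0 ≤ u a) (huρ : |u a - ρ| ≤ 1) :
    radialWeight m ρ * ((1 - 2 * (u a - ρ) ^ 2) * gaussianTail a) ≤ calibration m ρ u a := by
  have hW := radialWeight_pos m hρ0
  have hx : 0 ≤ 1 - (u a - ρ) ^ 2 := sub_nonneg.2 ((sq_le_one_iff_abs_le_one _).2 huρ)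
  have hsq := pow_le_pow_left₀ (mul_nonneg hW.le hx)
    (radialWeight_mul_one_sub_sq_le hρ0 hρ hu0) 2
  rw [calibration, ← mul_assoc]
  refine mul_le_mul_of_nonneg_right ?_ (gaussianTail_nonneg a)
  rw [le_div_iff₀ hW]
  refine le_trans ?_ hsq
  linear_combination mul_nonneg (sq_nonneg (radialWeight m ρ)) (sq_nonneg ((u a - ρ) ^ 2))

lemma energy_le_of_integral_add_calibration_le (hρ0 : 0 < ρ) (hρ : ρ ^ 2 = 2 * m) (ha : 0 ≤ a)
    (hu : LipschitzOnWith 1 u (Icc 0 a)) (hu0 : ∀ y ∈ Icc 0 a, 0 ≤ u y)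
    (huρ : ∀ y ∈ Icc 0 a, |u y - ρ| ≤ 1 / 2)
    (harea : (∫ y in (0 : ℝ)..a, gaussianDensity m u y) + calibration m ρ u a ≤
      radialWeight m ρ * gaussianTail 0) :
    3 / 16 * gaussianNormSq (deriv u) 0 a ≤
      gaussianNormSq (fun y => u y - ρ) 0 a + 2 * ((u a - ρ) ^ 2 * gaussianTail a) := by
  have haI : a ∈ Icc 0 a := right_mem_Icc.2 ha
  have hnear := radialWeight_mul_gaussianNormSq_le_integral hρ0 hρ ha hu hu0 huρ
  have hfar := radialWeight_mul_gaussianTail_le_calibration hρ0 hρ (hu0 a haI)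
    ((huρ a haI).trans (by norm_num))
  have htotal := (add_le_add hnear hfar).trans harea
  rw [← mul_add, ← integral_exp_add_gaussianTail 0 a] at htotal
  linarith [le_of_mul_le_mul_left htotal (radialWeight_pos m hρ0)]

end Energy

section HuiskenFunctional

variable {n : ℕ} {I : Set ℝ} {u : ℝ → ℝ}

lemma norm_revolutionMap_sq (n : ℕ) (u : ℝ → ℝ)
    (p : ℝ × Metric.sphere (0 : EuclideanSpace ℝ (Fin n)) 1) :
    ‖revolutionMap n u p‖ ^ 2 = u p.1 ^ 2 + p.1 ^ 2 := by
  rw [WithLp.prod_norm_sq_eq_of_L2]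
  simp [revolutionMap, norm_smul]

lemma aemeasurable_revolutionMap {μ : Measure ℝ}
    {σ : Measure (Metric.sphere (0 : EuclideanSpace ℝ (Fin n)) 1)} [SFinite σ]
    (hu : AEMeasurable u μ) : AEMeasurable (revolutionMap n u) (μ.prod σ) :=
  (WithLp.measurable_toLp 2 _).comp_aemeasurable
    ((hu.comp_fst.smul (measurable_subtype_coe.comp measurable_snd).aemeasurable).prodMk
      measurable_fst.aemeasurable)

lemma lintegral_norm_sq_revolutionMeasure (hu : AEMeasurable u (volume.restrict I))
    {φ : ℝ → ENNReal} (hφ : Measurable φ) :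
    ∫⁻ X, φ (‖X‖ ^ 2) ∂revolutionMeasure n I u =
      (volume : Measure (EuclideanSpace ℝ (Fin n))).toSphere univ *
        ∫⁻ y in I, ENNReal.ofReal (u y ^ (n - 1) * √(1 + deriv u y ^ 2)) * φ (u y ^ 2 + y ^ 2) := by
  set area : ℝ → ENNReal := fun y => ENNReal.ofReal (u y ^ (n - 1) * √(1 + deriv u y ^ 2))
  have harea : AEMeasurable area (volume.restrict I) :=
    ((hu.pow_const _).mul
      (((measurable_deriv u).pow_const 2).const_add 1).sqrt.aemeasurable).ennreal_ofReal
  have hφu : AEMeasurable (fun y => φ (u y ^ 2 + y ^ 2)) (volume.restrict I) :=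
    hφ.comp_aemeasurable ((hu.pow_const 2).add (by fun_prop))
  have hac := withDensity_absolutelyContinuous (volume.restrict I) area
  have hφX : Measurable fun X : AmbientSpace n => φ (‖X‖ ^ 2) := by fun_prop
  rw [revolutionMeasure,
    lintegral_map' hφX.aemeasurable (aemeasurable_revolutionMap (hu.mono_ac hac))]
  simp_rw [norm_revolutionMap_sq]
  rw [lintegral_prod _ (hφu.mono_ac hac).comp_fst]
  simp only [lintegral_const]
  rw [lintegral_mul_const'' _ (hφu.mono_ac hac),
    lintegral_withDensity_eq_lintegral_mul₀ harea hφu, mul_comm]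
  rfl

lemma huisken_revolutionMeasure (hu : AEMeasurable u (volume.restrict I)) :
    huisken n (revolutionMeasure n I u) =
      ENNReal.ofReal ((4 * π) ^ (-(n : ℝ) / 2)) *
        ((volume : Measure (EuclideanSpace ℝ (Fin n))).toSphere univ *
          ∫⁻ y in I, ENNReal.ofReal (gaussianDensity (n - 1) u y)) := by
  rw [huisken, lintegral_norm_sq_revolutionMeasure hu
    (φ := fun t => ENNReal.ofReal (exp (-t / 4))) (by fun_prop)]
  congr! 5 with y
  rw [← ENNReal.ofReal_mul' (exp_pos _).le, gaussianDensity, radialWeight, neg_add, add_div,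
    exp_add]
  congr 1
  ring

lemma gaussianDensity_const (m : ℕ) (ρ y : ℝ) :
    gaussianDensity m (fun _ => ρ) y = radialWeight m ρ * exp (-y ^ 2 / 4) := by
  simp [gaussianDensity]

lemma lintegral_gaussianDensity_const (m : ℕ) {ρ : ℝ} (hρ : 0 ≤ ρ) :
    ∫⁻ y : ℝ, ENNReal.ofReal (gaussianDensity m (fun _ => ρ) y) =
      ENNReal.ofReal (2 * (radialWeight m ρ * gaussianTail 0)) := by
  simp_rw [gaussianDensity_const]
  rw [← ofReal_integral_eq_lintegral_ofReal (integrable_exp_neg_sq_div_four.const_mul _)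
    (.of_forall fun y => mul_nonneg (radialWeight_nonneg m hρ) (exp_pos _).le),
    integral_const_mul, integral_exp_neg_sq_div_four, mul_left_comm]

lemma cylinderRadius_nonneg (n : ℕ) : 0 ≤ cylinderRadius n :=
  sqrt_nonneg _

lemma cylinderRadius_sq (hn : 1 ≤ n) : cylinderRadius n ^ 2 = 2 * ((n - 1 : ℕ) : ℝ) := by
  rw [cylinderRadius, ← Nat.cast_pred hn, sq_sqrt (by positivity)]

lemma cylinderRadius_pos (hn : 2 ≤ n) : 0 < cylinderRadius n := by
  have : (2 : ℝ) ≤ n := by exact_mod_cast hn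
  exact sqrt_pos.2 (by linarith)

lemma lintegral_gaussianDensity_le_of_huisken_le (hn : n ≠ 0)
    (hu : AEMeasurable u (volume.restrict I))
    (hH : huisken n (revolutionMeasure n I u) ≤ huisken n (cylinderMeasure n)) :
    ∫⁻ y in I, ENNReal.ofReal (gaussianDensity (n - 1) u y) ≤
      ENNReal.ofReal (2 * (radialWeight (n - 1) (cylinderRadius n) * gaussianTail 0)) := by
  have hsphere : (volume : Measure (EuclideanSpace ℝ (Fin n))).toSphere univ ≠ 0 := by
    rwa [Measure.measure_univ_ne_zero, Ne, Measure.toSphere_eq_zero_iff_finrank,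
      finrank_euclideanSpace_fin]
  rwa [cylinderMeasure, huisken_revolutionMeasure hu, huisken_revolutionMeasure aemeasurable_const,
    Measure.restrict_univ, lintegral_gaussianDensity_const _ (cylinderRadius_nonneg n),
    ENNReal.mul_le_mul_iff_right (by positivity) ENNReal.ofReal_ne_top,
    ENNReal.mul_le_mul_iff_right hsphere (measure_ne_top _ _)] at hH

end HuiskenFunctional

namespace IsConvexProfile

variable {n m : ℕ} {d a b : ℝ} {u : ℝ → ℝ}

lemma nonneg (hu : IsConvexProfile d u) {y : ℝ} (hy : y ∈ Icc (-d) d) : 0 ≤ u y := by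
  rcases eq_or_lt_of_le hy.2 with rfl | hlt
  · exact hu.tip.ge
  rcases eq_or_lt_of_le hy.1 with rfl | hgt
  · rw [hu.even d ⟨hlt.le, le_rfl⟩, hu.tip]
  · exact (hu.pos y ⟨hgt, hlt⟩).le

lemma exists_lipschitzOnWith (hu : IsConvexProfile d u) (hb : b < d) :
    ∃ K, LipschitzOnWith K u (Icc (-b) b) := by
  have hball : Metric.ball (0 : ℝ) d ⊆ Icc (-d) d := by
    simpa only [ball_eq_Ioo, zero_sub, zero_add] using Ioo_subset_Icc_self
  obtain ⟨K, hK⟩ := (hu.concave.subset hball (convex_ball 0 d)).exists_lipschitzOnWith_of_isBounded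
    (r' := (b + d) / 2) (by linarith)
    ((isCompact_Icc.image_of_continuousOn hu.continuous).isBounded.subset (image_mono hball))
  refine ⟨K, hK.mono ?_⟩
  rw [ball_eq_Ioo]
  exact Icc_subset_Ioo (by linarith) (by linarith)

lemma lipschitzOnWith_one {L ρ : ℝ} (hu : IsConvexProfile d u) (hL : 1 ≤ L) (hd : 4 * L ≤ d)
    (huρ : ∀ y : ℝ, |y| ≤ 4 * L → |u y - ρ| ≤ 1 / 2) :
    LipschitzOnWith 1 u (Icc 0 (2 * L)) := by
  have hball : Metric.ball (0 : ℝ) (4 * L) ⊆ Icc (-d) d := by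
    rw [ball_eq_Ioo]
    exact Ioo_subset_Icc_self.trans (Icc_subset_Icc (by linarith) (by linarith))
  have hconcave := (hu.concave.subset hball (convex_ball 0 (4 * L))).add_const (-ρ)
  have hlip := hconcave.lipschitzOnWith_of_abs_le (ε := L) (M := 1 / 2) (by linarith) fun y hy => by
    rw [dist_0_eq_abs] at hy
    simpa only [Pi.add_apply, sub_eq_add_neg] using huρ y hy.le
  have hconst : (2 * (1 / 2) / L).toNNReal ≤ 1 := by
    rw [toNNReal_le_one, div_le_one (by linarith)]
    linarith
  have hsub : Icc 0 (2 * L) ⊆ Metric.ball (0 : ℝ) (4 * L - L) := by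
    rw [ball_eq_Ioo]
    exact Icc_subset_Ioo (by linarith) (by linarith)
  refine LipschitzOnWith.of_dist_le_mul fun x hx y hy => ?_
  simpa only [Pi.add_apply, dist_add_right] using
    ((hlip.mono hsub).weaken hconst).dist_le_mul x hx y hy

lemma gaussianDensity_neg (hu : IsConvexProfile d u) (m : ℕ) {y : ℝ} (hy : y ∈ Ioo (-d) d) :
    gaussianDensity m u (-y) = gaussianDensity m u y := by
  have heven : (fun x => u (-x)) =ᶠ[𝓝 y] u := eventually_of_mem (Icc_mem_nhds hy.1 hy.2) hu.even
  have hderiv : deriv u (-y) = -deriv u y := by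
    rw [← heven.deriv_eq, deriv_comp_neg, neg_neg]
  simp only [gaussianDensity, hderiv, neg_sq, hu.even y (Ioo_subset_Icc_self hy)]

lemma integral_gaussianDensity_neg_self (hu : IsConvexProfile d u) (m : ℕ) (hb0 : 0 ≤ b)
    (hb : b < d) :
    ∫ y in -b..b, gaussianDensity m u y = 2 * ∫ y in (0 : ℝ)..b, gaussianDensity m u y := by
  obtain ⟨K, hK⟩ := hu.exists_lipschitzOnWith hb
  have hleft := intervalIntegrable_gaussianDensity m (neg_nonpos.2 hb0)
    (hK.mono (Icc_subset_Icc_right hb0))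
  have hright := intervalIntegrable_gaussianDensity m hb0
    (hK.mono (Icc_subset_Icc_left (neg_nonpos.2 hb0)))
  have hreflect : ∫ y in -b..0, gaussianDensity m u y = ∫ y in (0 : ℝ)..b, gaussianDensity m u y :=
    calc ∫ y in -b..0, gaussianDensity m u y
        = ∫ y in (0 : ℝ)..b, gaussianDensity m u (-y) := by
          rw [intervalIntegral.integral_comp_neg, neg_zero]
      _ = ∫ y in (0 : ℝ)..b, gaussianDensity m u y := by
          refine intervalIntegral.integral_congr fun y hy => ?_
          rw [uIcc_of_le hb0] at hy
          exact hu.gaussianDensity_neg m ⟨by linarith [hy.1], by linarith [hy.2]⟩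
  rw [← intervalIntegral.integral_add_adjacent_intervals hleft hright, hreflect, two_mul]

lemma integral_gaussianDensity_le (hu : IsConvexProfile d u) (hn : n ≠ 0) (hb0 : 0 ≤ b)
    (hb : b < d)
    (hH : huisken n (revolutionMeasure n (Icc (-d) d) u) ≤ huisken n (cylinderMeasure n)) :
    ∫ y in (0 : ℝ)..b, gaussianDensity (n - 1) u y ≤
      radialWeight (n - 1) (cylinderRadius n) * gaussianTail 0 := by
  obtain ⟨K, hK⟩ := hu.exists_lipschitzOnWith hb
  have hbb : -b ≤ b := neg_le_self hb0
  have hsub : Ioc (-b) b ⊆ Icc (-d) d :=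
    Ioc_subset_Icc_self.trans (Icc_subset_Icc (by linarith) hb.le)
  have hcylinder : 0 ≤ 2 * (radialWeight (n - 1) (cylinderRadius n) * gaussianTail 0) :=
    mul_nonneg zero_le_two
      (mul_nonneg (radialWeight_nonneg _ (cylinderRadius_nonneg n)) (gaussianTail_nonneg 0))
  suffices hsymm : ∫ y in -b..b, gaussianDensity (n - 1) u y ≤
      2 * (radialWeight (n - 1) (cylinderRadius n) * gaussianTail 0) by
    rw [hu.integral_gaussianDensity_neg_self _ hb0 hb] at hsymm
    linarith
  rw [← ENNReal.ofReal_le_ofReal_iff hcylinder, intervalIntegral.integral_of_le hbb,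
    ofReal_integral_eq_lintegral_ofReal (intervalIntegrable_gaussianDensity _ hbb hK).1
      ((ae_restrict_mem measurableSet_Ioc).mono fun y hy =>
        gaussianDensity_nonneg _ (hu.nonneg (hsub hy)))]
  exact (lintegral_mono_set hsub).trans (lintegral_gaussianDensity_le_of_huisken_le hn
    (hu.continuous.aemeasurable measurableSet_Icc) hH)

lemma tendsto_calibration_tip (hu : IsConvexProfile d u) (hd : 0 < d) (hm : m ≠ 0) (ρ : ℝ) :
    Tendsto (calibration m ρ u) (𝓝[<] d) (𝓝 0) := by
  have htip : Tendsto u (𝓝[<] d) (𝓝 0) := by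
    rw [← hu.tip, ← nhdsWithin_Ioo_eq_nhdsLT (by linarith : -d < d)]
    exact (hu.continuous d ⟨by linarith, le_rfl⟩).mono Ioo_subset_Icc_self
  have hw := ((contDiff_radialWeight m).continuous.tendsto 0).comp htip
  have hg := (contDiff_gaussianTail.continuous.tendsto d).mono_left
    (nhdsWithin_le_nhds (s := Iio d))
  have hzero : radialWeight m 0 ^ 2 / radialWeight m ρ * gaussianTail d = 0 := by
    simp [radialWeight, hm]
  rw [← hzero]
  exact ((hw.pow 2).div_const (radialWeight m ρ)).mul hg

lemma integral_add_calibration_le (hu : IsConvexProfile d u) (hn : 2 ≤ n)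
    (ha : 4 * cylinderRadius n ≤ a) (had : a < d)
    (hH : huisken n (revolutionMeasure n (Icc (-d) d) u) ≤ huisken n (cylinderMeasure n)) :
    (∫ y in (0 : ℝ)..a, gaussianDensity (n - 1) u y) + calibration (n - 1) (cylinderRadius n) u a ≤
      radialWeight (n - 1) (cylinderRadius n) * gaussianTail 0 := by
  have hρ := cylinderRadius_pos hn
  have ha0 : 0 ≤ a := by linarith
  have hlim := (hu.tendsto_calibration_tip (by linarith) (Nat.sub_ne_zero_of_lt hn)
    (cylinderRadius n)).const_add (radialWeight (n - 1) (cylinderRadius n) * gaussianTail 0)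
  rw [add_zero] at hlim
  refine ge_of_tendsto hlim ?_
  filter_upwards [Ioo_mem_nhdsLT had] with b hb
  obtain ⟨K, hK⟩ := hu.exists_lipschitzOnWith hb.2
  have hinner := hK.mono (Icc_subset_Icc (by linarith [hb.1] : -b ≤ 0) hb.1.le)
  have houter := hK.mono (Icc_subset_Icc_left (by linarith [hb.1] : -b ≤ a))
  have harea := hu.integral_gaussianDensity_le (by omega) (ha0.trans hb.1.le) hb.2 hH
  have hcalibration := calibration_sub_calibration_le hρ (cylinderRadius_sq (by omega)) ha hb.1.le
    houter fun y hy => hu.nonneg ⟨by linarith [hy.1], hy.2.trans hb.2.le⟩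
  rw [← intervalIntegral.integral_add_adjacent_intervals
    (intervalIntegrable_gaussianDensity _ ha0 hinner)
    (intervalIntegrable_gaussianDensity _ hb.1.le houter)] at harea
  linarith

end IsConvexProfile

theorem mainTheorem8 (n : ℕ) (hn : 2 ≤ n) :
    ∃ L₀ > (0 : ℝ), ∃ δ₀ > (0 : ℝ), ∃ C > (0 : ℝ),
      ∀ (L δ d : ℝ) (u : ℝ → ℝ), L₀ < L → 0 < δ → δ < δ₀ → 4 * L ≤ d →
        IsConvexProfile d u →
        huisken n (revolutionMeasure n (Icc (-d) d) u) ≤ huisken n (cylinderMeasure n) →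
        (∀ y : ℝ, |y| ≤ 4 * L → |u y - cylinderRadius n| ≤ δ) →
        ∀ v : ℝ → ℝ, v = (fun y => u y - cylinderRadius n) →
          IntervalIntegrable (fun y => deriv v y ^ 2 * Real.exp (-y ^ 2 / 4)) volume 0 (2 * L) ∧
          (∫ y in (0 : ℝ)..(2 * L), deriv v y ^ 2 * Real.exp (-y ^ 2 / 4)) ≤
            C * ∫ y in (0 : ℝ)..L, v y ^ 2 * Real.exp (-y ^ 2 / 4) ∧
          (∫ y in L..(2 * L), v y ^ 2 * Real.exp (-y ^ 2 / 4)) ≤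
            C / L ^ 2 * ∫ y in (0 : ℝ)..L, v y ^ 2 * Real.exp (-y ^ 2 / 4) := by
  have hρ := cylinderRadius_pos hn
  refine ⟨20 + 2 * cylinderRadius n, by positivity, 1 / 2, by norm_num, 200, by norm_num, ?_⟩
  rintro L δ d u hL - hδ hLd hu hH hclose v rfl
  have hL0 : 0 < L := by linarith
  have huρ : ∀ y, |y| ≤ 4 * L → |u y - cylinderRadius n| ≤ 1 / 2 :=
    fun y hy => (hclose y hy).trans hδ.le
  have hu1 := hu.lipschitzOnWith_one (by linarith) hLd huρ
  have harea := hu.integral_add_calibration_le hn (a := 2 * L) (by linarith) (by linarith) hH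
  have henergy := energy_le_of_integral_add_calibration_le hρ (cylinderRadius_sq (by omega))
    (by linarith) hu1 (fun y hy => hu.nonneg ⟨by linarith [hy.1], by linarith [hy.2]⟩)
    (fun y hy => huρ y (by rw [abs_of_nonneg hy.1]; linarith [hy.2])) harea
  have hderiv : deriv (fun y => u y - cylinderRadius n) = deriv u := by
    funext y
    exact deriv_sub_const _
  have hv1 : LipschitzOnWith 1 (fun y => u y - cylinderRadius n) (Icc 0 (2 * L)) :=
    .of_dist_le_mul fun x hx y hy => by simpa only [dist_sub_right] using hu1.dist_le_mul x hx y hy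
  rw [← hderiv] at henergy
  obtain ⟨hderivSq, hfarSq⟩ := gaussianNormSq_le_of_energy_le (by linarith) hv1 henergy
  refine ⟨intervalIntegrable_deriv_sq_mul_exp (by linarith) hv1, hderivSq, ?_⟩
  rw [div_mul_eq_mul_div, le_div_iff₀' (by positivity)]
  exact hfarSq
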